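/- Let $\mathbb R^n$ carry the Euclidean norm and let $f:\mathbb R\times[0,\infty)\to\mathbb R$, $\Theta:\mathbb R^n\to\mathbb R$, $u_0:\mathbb R^n\to\mathbb R$ satisfy: (A1) $f$ is bounded and continuous, and there is a modulus of continuity $\omega_f$ with $|f(r,q_1)-f(r,q_2)|\le\omega_f(|q_1-q_2|)$ for all $r\in\mathbb R$, $q_1,q_2\ge0$. (A2) $f(r_1,q)\le f(r_2,q)$ for $r_1<r_2$, $q\ge 0$, and $f(r,q_1)<f(r,q_2)$ for $r\in\mathbb R$, $0\le q_1<q_2$. (A3) $\Theta\in L^1(\mathbb R^n)$ and $\Theta>0$ on $\mathbb R^n$; put $\mu(A)=\int_A\Theta(x)\,dx$ for measurable $A\subset\mathbb R^n$. (A4) $u_0$ is uniformly continuous and $\lim_{R\to\infty}\inf\{u_0(y):|y|\ge R\}>u_0(x)$ for every $x\in\mathbb R^n$ (the limit may be $+\infty$). Let $\bar h\in\mathbb R$ satisfy $\inf u_0\le\bar h\le\sup u_0$ and $$f\big(\bar h,\mu(\{u_0<\bar h\})\big)\le 0\le f\big(\bar h,\mu(\{u_0\le\bar h\})\big).$$ A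 locally bounded upper semicontinuous function $u:\mathbb R^n\times(0,\infty)\to\mathbb R$ is a viscosity subsolution of $$u_t+|\nabla u|\,f\big(u(x,t),\mu(\{u(\cdot,t)<u(x,t)\})\big)=0\quad\text{in }\mathbb R^n\times(0,\infty)\tag{1}$$ if, whenever $\varphi\in C^1(\mathbb R^n\times(0,\infty))$ and $u-\varphi$ has a local maximum at $(x_0,t_0)$, one has $$\varphi_t(x_0,t_0)+|\nabla\varphi(x_0,t_0)|\,f\big(u(x_0,t_0),\mu(\{u(\cdot,t_0)<u(x_0,t_0)\})\big)\le0.$$ A locally bounded lower semicontinuous function $u$ is a viscosity supersolution if, whenever $\varphi\in C^1(\mathbb R^n\times(0,\infty))$ and $u-\varphi$ has a local minimum at $(x_0,t_0)$, one has $$\varphi_t(x_0,t_0)+|\nabla\varphi(x_0,t_0)|\,f\big(u(x_0,t_0),\mu(\{u(\cdot,t_0)\le u(x_0,t_0)\})\big)\ge0.$$ A viscosity solution is a continuous function that is both. Let $u:\mathbb R^n\times[0,\infty)\to\mathbb R$ be the (unique) solution of the Cauchy problem for (1) with initial datum $u_0$, that is: $u$ is continuous on $\mathbb R^n\times[0,\infty)$,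 is a viscosity solution of (1), satisfies $u(\cdot,0)=u_0$, and for every $T>0$ there is $M_T>0$ with $|u(x,t)|\le M_T(|x|+1)$ for all $(x,t)\in\mathbb R^n\times[0,T]$. Then for every compact set $K\subset\mathbb R^n$, $u(\cdot,t)\to\bar h$ uniformly on $K$ as $t\to\infty$. -/

import Mathlib

open Set Filter Topology MeasureTheory

noncomputable section

/-- The measure `μ(A) = ∫_A Θ(x) dx` of a set `A ⊆ ℝⁿ` (a real number, as `Θ` is integrable). -/
def mass {n : ℕ} (Θ : EuclideanSpace ℝ (Fin n) → ℝ) (A : Set (EuclideanSpace ℝ (Fin n))) : ℝ :=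
  ∫ x in A, Θ x

/-- `ω : [0,∞) → [0,∞)` is a modulus of continuity: nondecreasing, `ω(0) = 0`, and
`ω(s) → 0` as `s → 0+`.  (Values at negative arguments are irrelevant.) -/
structure IsModulus (ω : ℝ → ℝ) : Prop where
  zero : ω 0 = 0
  mono : MonotoneOn ω (Ici 0)
  tendsto_zero : Tendsto ω (𝓝[>] 0) (𝓝 0)

/-- Regularity of the velocity function `f : ℝ × [0,∞) → ℝ`: bounded, continuous, and uniformly continuous in the
second variable with a modulus that does not depend on the first.
(Values of `f r q` with `q < 0` are irrelevant.) -/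
structure VelocityRegular (f : ℝ → ℝ → ℝ) : Prop where
  bounded : ∃ M : ℝ, ∀ r q : ℝ, 0 ≤ q → |f r q| ≤ M
  continuousOn : ContinuousOn (fun p : ℝ × ℝ => f p.1 p.2) (univ ×ˢ Ici 0)
  modulus : ∃ ω : ℝ → ℝ, IsModulus ω ∧
    ∀ r q₁ q₂ : ℝ, 0 ≤ q₁ → 0 ≤ q₂ → |f r q₁ - f r q₂| ≤ ω |q₁ - q₂|

/-- Monotonicity of the velocity function: `f` is nondecreasing in the first variable and strictly increasing in the
second one. -/
structure VelocityMonotone (f : ℝ → ℝ → ℝ) : Prop where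
  mono_left : ∀ r₁ r₂ q : ℝ, r₁ < r₂ → 0 ≤ q → f r₁ q ≤ f r₂ q
  strictMono_right : ∀ r q₁ q₂ : ℝ, 0 ≤ q₁ → q₁ < q₂ → f r q₁ < f r q₂

/-- Assumption on the density of the measure: `Θ ∈ L¹(ℝⁿ)` and `Θ > 0`. -/
structure PositiveDensity {n : ℕ} (Θ : EuclideanSpace ℝ (Fin n) → ℝ) : Prop where
  integrable : Integrable Θ
  pos : ∀ x, 0 < Θ x

/-- Assumption on the initial datum: `u₀` is uniformly continuous, and the limit
`lim_{R → ∞} inf {u₀(y) : |y| ≥ R}` (finite or `+∞`) exceeds every value of `u₀`. -/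
structure CoerciveDatum {n : ℕ} (u₀ : EuclideanSpace ℝ (Fin n) → ℝ) : Prop where
  uniformContinuous : UniformContinuous u₀
  coercive : ∃ L : EReal,
    Tendsto (fun R : ℝ => ⨅ y ∈ {y : EuclideanSpace ℝ (Fin n) | R ≤ ‖y‖}, (u₀ y : EReal))
      atTop (𝓝 L) ∧
    ∀ x, (u₀ x : EReal) < L

/-- The condition `f(h̄, μ({u₀ < h̄})) ≤ 0 ≤ f(h̄, μ({u₀ ≤ h̄}))`. -/
def IsThreshold {n : ℕ} (f : ℝ → ℝ → ℝ) (Θ u₀ : EuclideanSpace ℝ (Fin n) → ℝ) (hbar : ℝ) : Prop :=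
  f hbar (mass Θ {x | u₀ x < hbar}) ≤ 0 ∧ 0 ≤ f hbar (mass Θ {x | u₀ x ≤ hbar})

/-- The open space-time domain `ℝⁿ × (0,∞)`. -/
def spaceTime (n : ℕ) : Set (EuclideanSpace ℝ (Fin n) × ℝ) := univ ×ˢ Ioi 0

/-- `u` is locally bounded in `ℝⁿ × (0,∞)`. -/
def LocallyBdd {n : ℕ} (u : EuclideanSpace ℝ (Fin n) → ℝ → ℝ) : Prop :=
  ∀ p ∈ spaceTime n, ∃ C : ℝ, ∀ᶠ z : EuclideanSpace ℝ (Fin n) × ℝ in 𝓝 p, |u z.1 z.2| ≤ C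

/-- Viscosity subsolution in `ℝⁿ × (0,∞)` of
`u_t + |∇u| f(u(x,t), μ({u(·,t) < u(x,t)})) = 0`. -/
structure IsViscositySubsolution {n : ℕ} (f : ℝ → ℝ → ℝ) (Θ : EuclideanSpace ℝ (Fin n) → ℝ)
    (u : EuclideanSpace ℝ (Fin n) → ℝ → ℝ) : Prop where
  locallyBdd : LocallyBdd u
  usc : UpperSemicontinuousOn (fun z : EuclideanSpace ℝ (Fin n) × ℝ => u z.1 z.2) (spaceTime n)
  test : ∀ (x₀ : EuclideanSpace ℝ (Fin n)) (t₀ : ℝ), 0 < t₀ →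
    ∀ φ : EuclideanSpace ℝ (Fin n) × ℝ → ℝ, ContDiffOn ℝ 1 φ (spaceTime n) →
      IsLocalMax (fun z : EuclideanSpace ℝ (Fin n) × ℝ => u z.1 z.2 - φ z) (x₀, t₀) →
      deriv (fun t => φ (x₀, t)) t₀ +
        ‖gradient (fun x => φ (x, t₀)) x₀‖ * f (u x₀ t₀) (mass Θ {y | u y t₀ < u x₀ t₀}) ≤ 0

/-- Viscosity supersolution in `ℝⁿ × (0,∞)` of the same equation; the nonlocal term is now
evaluated on the non-strict sublevel set. -/
structure IsViscositySupersolution {n : ℕ} (f : ℝ → ℝ → ℝ) (Θ : EuclideanSpace ℝ (Fin n) → ℝ)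
    (u : EuclideanSpace ℝ (Fin n) → ℝ → ℝ) : Prop where
  locallyBdd : LocallyBdd u
  lsc : LowerSemicontinuousOn (fun z : EuclideanSpace ℝ (Fin n) × ℝ => u z.1 z.2) (spaceTime n)
  test : ∀ (x₀ : EuclideanSpace ℝ (Fin n)) (t₀ : ℝ), 0 < t₀ →
    ∀ φ : EuclideanSpace ℝ (Fin n) × ℝ → ℝ, ContDiffOn ℝ 1 φ (spaceTime n) →
      IsLocalMin (fun z : EuclideanSpace ℝ (Fin n) × ℝ => u z.1 z.2 - φ z) (x₀, t₀) →
      0 ≤ deriv (fun t => φ (x₀, t)) t₀ +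
        ‖gradient (fun x => φ (x, t₀)) x₀‖ * f (u x₀ t₀) (mass Θ {y | u y t₀ ≤ u x₀ t₀})

/-- Viscosity solution in `ℝⁿ × (0,∞)`: continuous there, and both a sub- and a supersolution. -/
structure IsViscositySolution {n : ℕ} (f : ℝ → ℝ → ℝ) (Θ : EuclideanSpace ℝ (Fin n) → ℝ)
    (u : EuclideanSpace ℝ (Fin n) → ℝ → ℝ) : Prop where
  continuousOn : ContinuousOn (fun z : EuclideanSpace ℝ (Fin n) × ℝ => u z.1 z.2) (spaceTime n)
  sub : IsViscositySubsolution f Θ u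
  super : IsViscositySupersolution f Θ u

/-- Linear growth, locally uniformly in time: for every `T > 0` there is `M_T > 0` with
`|u(x,t)| ≤ M_T (|x| + 1)` on `ℝⁿ × [0,T]`. -/
def LinearGrowth {n : ℕ} (u : EuclideanSpace ℝ (Fin n) → ℝ → ℝ) : Prop :=
  ∀ T : ℝ, 0 < T → ∃ M : ℝ, 0 < M ∧
    ∀ (x : EuclideanSpace ℝ (Fin n)) (t : ℝ), 0 ≤ t → t ≤ T → |u x t| ≤ M * (‖x‖ + 1)

/-- `u` is a solution of the Cauchy problem with initial datum `u₀`, in the class in which the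
solution is unique: continuous on `ℝⁿ × [0,∞)` and of linear growth. -/
structure IsCauchySolution {n : ℕ} (f : ℝ → ℝ → ℝ) (Θ u₀ : EuclideanSpace ℝ (Fin n) → ℝ)
    (u : EuclideanSpace ℝ (Fin n) → ℝ → ℝ) : Prop where
  continuousOn : ContinuousOn (fun z : EuclideanSpace ℝ (Fin n) × ℝ => u z.1 z.2) (univ ×ˢ Ici 0)
  solution : IsViscositySolution f Θ u
  initial : ∀ x, u x 0 = u₀ x
  growth : LinearGrowth u

end

/-! The threshold condition gives sublevel sets above `hbar` a positive front velocity. Take `a`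
slightly above `hbar`. If `u₀` exceeds `hbar` somewhere, `{hbar < u₀ < a}` is open and nonempty, so
it has positive mass and strict monotonicity of `f` gives `f(a, μ{u₀ < a}) > 0`. By continuity this
survives replacing `{u₀ < a}` by a slightly smaller set `A`. As long as `A` stays inside `{u ≤ a}`,
every point above level `a` sees a nonlocal mass of at least `μ(A)`, so `u_t + c|∇u| ≤ 0` there with
one fixed `c > 0`. Finite speed keeps `A` covered for a short time, the positive velocity meanwhile
keeps the original set covered, and the argument restarts (`NonlocalSub.exists_eikonalSubAbove`).
The sublevel set then expands at speed `c` and swallows any compact set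
(`NonlocalSub.eventually_le`).

The lower bound is the same result for `-u`, with velocity `-f(-r, I - q)`, `I` the total mass.
Speeds of propagation come from a single exponential barrier (`le_of_eikonalSubAbove`). -/

/-! ### Barriers and speed of propagation. -/

/-- At every point of `{v > a}` with time in `(t₀, t₂)`, the function `v` satisfies
`v_t + c |∇v| ≤ 0` in the sense of test functions touching from above. -/
def EikonalSubAbove {n : ℕ} (v : EuclideanSpace ℝ (Fin n) → ℝ → ℝ) (c a t₀ t₂ : ℝ) : Prop :=
  ∀ (x : EuclideanSpace ℝ (Fin n)) (t : ℝ), t₀ < t → t < t₂ → a < v x t →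
    ∀ φ : EuclideanSpace ℝ (Fin n) × ℝ → ℝ, ContDiff ℝ 1 φ →
      IsLocalMax (fun z : EuclideanSpace ℝ (Fin n) × ℝ => v z.1 z.2 - φ z) (x, t) →
      deriv (fun s => φ (x, s)) t + c * ‖gradient (fun y => φ (y, t)) x‖ ≤ 0

theorem EikonalSubAbove.mono {n : ℕ} {v : EuclideanSpace ℝ (Fin n) → ℝ → ℝ} {c a a' t₀ t₂ : ℝ}
    (h : EikonalSubAbove v c a t₀ t₂) (ha : a ≤ a') : EikonalSubAbove v c a' t₀ t₂ :=
  fun x t h0 h2 hx => h x t h0 h2 (ha.trans_lt hx)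

/-- The exponential barrier `a + δ exp (L (κ (t - t₁) + |x - x₀ - (t - t₀) p|² / (2R)))`. -/
noncomputable def expBarrier {n : ℕ} (a δ L κ R t₀ t₁ : ℝ) (x₀ p : EuclideanSpace ℝ (Fin n))
    (z : EuclideanSpace ℝ (Fin n) × ℝ) : ℝ :=
  a + δ * Real.exp (L * (κ * (z.2 - t₁) + ‖z.1 - x₀ - (z.2 - t₀) • p‖ ^ 2 / (2 * R)))

section Barrier

variable {n : ℕ} (a δ L κ R t₀ t₁ : ℝ) (x₀ p : EuclideanSpace ℝ (Fin n))

theorem contDiff_expBarrier : ContDiff ℝ 1 (expBarrier a δ L κ R t₀ t₁ x₀ p) := by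
  unfold expBarrier
  have h : ContDiff ℝ 1 (fun z : EuclideanSpace ℝ (Fin n) × ℝ =>
      ‖z.1 - x₀ - (z.2 - t₀) • p‖ ^ 2) := by
    apply ContDiff.norm_sq ℝ
    fun_prop
  fun_prop

theorem hasDerivAt_expBarrier (x : EuclideanSpace ℝ (Fin n)) (t : ℝ) :
    HasDerivAt (fun s => expBarrier a δ L κ R t₀ t₁ x₀ p (x, s))
      (δ * (Real.exp (L * (κ * (t - t₁) + ‖x - x₀ - (t - t₀) • p‖ ^ 2 / (2 * R))) *
        (L * (κ + 2 * inner ℝ (x - x₀ - (t - t₀) • p) (-p) / (2 * R))))) t := by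
  unfold expBarrier
  have h1 : HasDerivAt (fun s : ℝ => x - x₀ - (s - t₀) • p) (-p) t := by
    have := (((hasDerivAt_id t).sub_const t₀).smul_const p).const_sub (x - x₀)
    simpa using this
  have h2 := h1.norm_sq
  have h3 : HasDerivAt (fun s : ℝ => κ * (s - t₁)) κ t := by
    simpa using ((hasDerivAt_id t).sub_const t₁).const_mul κ
  exact ((((h3.add (h2.div_const (2 * R))).const_mul L).exp).const_mul δ).const_add a

theorem hasGradientAt_expBarrier (x : EuclideanSpace ℝ (Fin n)) (t : ℝ) :
    HasGradientAt (fun y => expBarrier a δ L κ R t₀ t₁ x₀ p (y, t))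
      ((δ * (Real.exp (L * (κ * (t - t₁) + ‖x - x₀ - (t - t₀) • p‖ ^ 2 / (2 * R))) *
        (L * (2 / (2 * R))))) • (x - x₀ - (t - t₀) • p)) x := by
  unfold expBarrier
  rw [hasGradientAt_iff_hasFDerivAt]
  have h1 : HasFDerivAt (fun y : EuclideanSpace ℝ (Fin n) => y - x₀ - (t - t₀) • p)
      (ContinuousLinearMap.id ℝ _) x :=
    ((hasFDerivAt_id x).sub_const x₀).sub_const _
  have h2 := h1.norm_sq
  have h3 := ((((h2.mul_const (2 * R)⁻¹).const_add (κ * (t - t₁))).const_mul L).exp.const_mul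
    δ).const_add a
  simp only [← div_eq_mul_inv] at h3
  refine h3.congr_fderiv ?_
  ext y
  simp
  ring

end Barrier

/-- Comparison in a tube of radius `R` moving with velocity `p`. The condition `hp` makes the
barrier a strict supersolution there, and the barrier lies above `a`, so any contact from above
occurs where `hsub` applies. -/
theorem le_of_eikonalSubAbove {n : ℕ} {v : EuclideanSpace ℝ (Fin n) → ℝ → ℝ}
    {c a t₀ t₁ t₂ κ R : ℝ} {x₀ p : EuclideanSpace ℝ (Fin n)}
    (hv : ContinuousOn (fun z : EuclideanSpace ℝ (Fin n) × ℝ => v z.1 z.2) (univ ×ˢ Ici t₀))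
    (h01 : t₀ ≤ t₁) (h12 : t₁ < t₂) (hκ : 0 < κ)
    (hp : ∀ q : EuclideanSpace ℝ (Fin n), ‖q‖ ≤ 1 → 0 < κ - inner ℝ q p + c * ‖q‖)
    (hR : κ * (t₁ - t₀) < R / 2) (hsub : EikonalSubAbove v c a t₀ t₂)
    (h0 : ∀ y ∈ Metric.closedBall x₀ R, v y t₀ ≤ a) :
    v (x₀ + (t₁ - t₀) • p) t₁ ≤ a := by
  by_contra! hlt
  have hRpos : 0 < R := by nlinarith [mul_nonneg hκ.le (sub_nonneg.2 h01)]
  obtain ⟨t₃, h13, h32⟩ := exists_between h12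
  set D : Set (EuclideanSpace ℝ (Fin n) × ℝ) :=
    (fun z : EuclideanSpace ℝ (Fin n) × ℝ => (x₀ + (z.2 - t₀) • p + z.1, z.2)) ''
      (Metric.closedBall 0 R ×ˢ Icc t₀ t₃)
  have memD : ∀ z : EuclideanSpace ℝ (Fin n) × ℝ,
      z ∈ D ↔ ‖z.1 - x₀ - (z.2 - t₀) • p‖ ≤ R ∧ t₀ ≤ z.2 ∧ z.2 ≤ t₃ := by
    rintro ⟨x, t⟩
    constructor
    · rintro ⟨⟨y, s⟩, ⟨hy, hs⟩, hz⟩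
      simp only [Prod.mk.injEq] at hz
      obtain ⟨rfl, rfl⟩ := hz
      refine ⟨?_, hs.1, hs.2⟩
      have : x₀ + (s - t₀) • p + y - x₀ - (s - t₀) • p = y := by abel
      simpa [this] using hy
    · rintro ⟨hx, ht⟩
      refine ⟨(x - x₀ - (t - t₀) • p, t), ⟨by simpa using hx, ht⟩, ?_⟩
      simp only [Prod.mk.injEq, and_true]
      abel
  have hDc : IsCompact D := by
    refine ((isCompact_closedBall _ _).prod isCompact_Icc).image ?_
    fun_prop
  have hvD : ContinuousOn (fun z : EuclideanSpace ℝ (Fin n) × ℝ => v z.1 z.2) D :=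
    hv.mono fun z hz => ⟨mem_univ _, ((memD z).1 hz).2.1⟩
  obtain ⟨C, hC⟩ := hDc.bddAbove_image hvD
  have hC' : ∀ z ∈ D, v z.1 z.2 ≤ C := fun z hz => hC ⟨z, hz, rfl⟩
  obtain ⟨δ, hδ, hδ'⟩ : ∃ δ, 0 < δ ∧ a + δ < v (x₀ + (t₁ - t₀) • p) t₁ :=
    ⟨(v (x₀ + (t₁ - t₀) • p) t₁ - a) / 2, by linarith, by linarith⟩
  -- `γ` bounds the exponent (before the factor `L`) from below on the lateral boundary and at the
  -- final time `t₃`; a large `L` then lifts the barrier above `max v` there.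
  obtain ⟨γ, hγ, hγ1, hγ2⟩ : ∃ γ, 0 < γ ∧ γ ≤ R / 2 - κ * (t₁ - t₀) ∧ γ ≤ κ * (t₃ - t₁) :=
    ⟨_, lt_min (by linarith) (mul_pos hκ (by linarith)), min_le_left _ _, min_le_right _ _⟩
  obtain ⟨L, hL, hLC⟩ : ∃ L, 0 < L ∧ C - a < δ * Real.exp (L * γ) := by
    refine ⟨(|C - a| + 1) / (δ * γ), by positivity, ?_⟩
    have h1 := Real.add_one_le_exp ((|C - a| + 1) / (δ * γ) * γ)
    have h2 : δ * ((|C - a| + 1) / (δ * γ) * γ) = |C - a| + 1 := by field_simp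
    nlinarith [mul_le_mul_of_nonneg_left h1 hδ.le, le_abs_self (C - a)]
  set ψ := expBarrier a δ L κ R t₀ t₁ x₀ p with hψ
  have hψc : ContDiff ℝ 1 ψ := contDiff_expBarrier ..
  have hψa : ∀ z, a < ψ z := fun z => lt_add_of_pos_right _ (mul_pos hδ (Real.exp_pos _))
  have hψC : ∀ z : EuclideanSpace ℝ (Fin n) × ℝ,
      γ ≤ κ * (z.2 - t₁) + ‖z.1 - x₀ - (z.2 - t₀) • p‖ ^ 2 / (2 * R) → C < ψ z := by
    intro z hz
    have := mul_le_mul_of_nonneg_left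
      (Real.exp_le_exp.2 (mul_le_mul_of_nonneg_left hz hL.le)) hδ.le
    simp only [hψ, expBarrier]
    linarith
  have h1D : (x₀ + (t₁ - t₀) • p, t₁) ∈ D := by
    rw [memD]
    refine ⟨?_, h01, h13.le⟩
    simp [hRpos.le]
  obtain ⟨z, hz, hmax⟩ := hDc.exists_isMaxOn ⟨_, h1D⟩ (hvD.sub hψc.continuous.continuousOn)
  have hψ1 : ψ (x₀ + (t₁ - t₀) • p, t₁) = a + δ := by simp [hψ, expBarrier]
  have hzpos : ψ z < v z.1 z.2 := by
    have := hmax h1D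
    simp only [mem_ofPred_eq, Pi.sub_apply, hψ1] at this
    linarith
  obtain ⟨x, t⟩ := z
  obtain ⟨hxR, ht0, ht3⟩ := (memD _).1 hz
  simp only at hxR ht0 ht3 hzpos
  have ht0' : t₀ < t := by
    refine lt_of_le_of_ne ht0 fun h => ?_
    subst h
    have := h0 x (by simpa [dist_eq_norm] using hxR)
    linarith [hψa (x, t₀)]
  have ht3' : t < t₃ := by
    refine lt_of_le_of_ne ht3 fun h => ?_
    subst h
    have := hψC (x, t) (by
      have : 0 ≤ ‖x - x₀ - (t - t₀) • p‖ ^ 2 / (2 * R) := by positivity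
      simp only
      linarith)
    linarith [hC' _ hz]
  have hxR' : ‖x - x₀ - (t - t₀) • p‖ < R := by
    refine lt_of_le_of_ne hxR fun h => ?_
    have := hψC (x, t) (by
      have h2 : R ^ 2 / (2 * R) = R / 2 := by field_simp
      simp only [h, h2]
      nlinarith)
    linarith [hC' _ hz]
  have hloc : IsLocalMax (fun z : EuclideanSpace ℝ (Fin n) × ℝ => v z.1 z.2 - ψ z) (x, t) := by
    refine hmax.isLocalMax ?_
    have ho : IsOpen {z : EuclideanSpace ℝ (Fin n) × ℝ |
        ‖z.1 - x₀ - (z.2 - t₀) • p‖ < R ∧ t₀ < z.2 ∧ z.2 < t₃} :=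
      (isOpen_lt (by fun_prop) continuous_const).and
        ((isOpen_lt continuous_const continuous_snd).and
          (isOpen_lt continuous_snd continuous_const))
    exact mem_of_superset (ho.mem_nhds ⟨hxR', ht0', ht3'⟩)
      fun z hz => (memD z).2 ⟨hz.1.le, hz.2.1.le, hz.2.2.le⟩
  have htest := hsub x t ht0' (ht3'.trans h32) ((hψa _).trans hzpos) ψ hψc hloc
  rw [(hasDerivAt_expBarrier ..).deriv, (hasGradientAt_expBarrier ..).gradient, norm_smul] at htest
  set e := x - x₀ - (t - t₀) • p
  set W := Real.exp (L * (κ * (t - t₁) + ‖e‖ ^ 2 / (2 * R)))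
  have hW : 0 < W := Real.exp_pos _
  -- Up to a positive factor, the barrier's derivatives give `κ - ⟨q, p⟩ + c‖q‖` with `q = e / R`.
  have hq := hp (R⁻¹ • e) (by
    rw [norm_smul, norm_inv, Real.norm_of_nonneg hRpos.le, inv_mul_le_iff₀ hRpos]
    linarith)
  rw [norm_smul, inner_smul_left, norm_inv, Real.norm_of_nonneg hRpos.le] at hq
  simp only [map_inv₀, conj_trivial] at hq
  rw [Real.norm_of_nonneg (by positivity), inner_neg_right] at htest
  have hpos : 0 < δ * W * L * (κ - R⁻¹ * inner ℝ e p + c * (R⁻¹ * ‖e‖)) := by positivity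
  have heq : δ * (W * (L * (κ + 2 * -inner ℝ e p / (2 * R)))) +
      c * (δ * (W * (L * (2 / (2 * R)))) * ‖e‖) =
      δ * W * L * (κ - R⁻¹ * inner ℝ e p + c * (R⁻¹ * ‖e‖)) := by
    field_simp
    ring
  linarith

/-- Where `v_t + c |∇v| ≤ 0` above the level `a`, the sublevel set `{v ≤ a}` moves
outwards with speed at least `c`. -/
theorem EikonalSubAbove.le_of_norm_le {n : ℕ} {v : EuclideanSpace ℝ (Fin n) → ℝ → ℝ}
    {c a t₀ t₁ t₂ : ℝ} {x₀ p : EuclideanSpace ℝ (Fin n)} (hsub : EikonalSubAbove v c a t₀ t₂)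
    (hv : ContinuousOn (fun z : EuclideanSpace ℝ (Fin n) × ℝ => v z.1 z.2) (univ ×ˢ Ici t₀))
    (h01 : t₀ ≤ t₁) (h12 : t₁ < t₂) (hp : ‖p‖ ≤ c) (h0 : v x₀ t₀ ≤ a) :
    v (x₀ + (t₁ - t₀) • p) t₁ ≤ a := by
  refine le_of_forall_pos_le_add fun η hη => ?_
  have hvt : Continuous fun y => v y t₀ := by
    refine hv.comp_continuous (f := fun y => (y, t₀)) (by fun_prop) fun y => ⟨mem_univ _, ?_⟩
    exact le_refl t₀
  have hnear : ∀ᶠ y in 𝓝 x₀, v y t₀ < a + η :=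
    hvt.continuousAt.eventually_lt_const (by linarith)
  obtain ⟨R, hR, hRy⟩ := Metric.nhds_basis_closedBall.eventually_iff.1 hnear
  have h10 : 0 ≤ t₁ - t₀ := sub_nonneg.2 h01
  -- Since `‖p‖ ≤ c`, any `κ > 0` satisfies `hp`; this one keeps `κ (t₁ - t₀)` below `R / 4`.
  refine le_of_eikonalSubAbove (κ := R / (4 * (t₁ - t₀ + 1))) (R := R) hv h01 h12 (by positivity)
    (fun q hq => ?_) ?_ (hsub.mono (by linarith)) fun y hy => (hRy hy).le
  · have h1 := real_inner_le_norm q p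
    have h2 := mul_le_mul_of_nonneg_left hp (norm_nonneg q)
    have h3 : 0 < R / (4 * (t₁ - t₀ + 1)) := by positivity
    linarith
  · rw [div_mul_eq_mul_div, div_lt_div_iff₀ (by positivity) (by positivity)]
    nlinarith

/-- Finite speed of propagation. -/
theorem EikonalSubAbove.le_of_closedBall {n : ℕ} {v : EuclideanSpace ℝ (Fin n) → ℝ → ℝ}
    {M a t₀ t₁ t₂ R : ℝ} {x : EuclideanSpace ℝ (Fin n)} (hsub : EikonalSubAbove v (-M) a t₀ t₂)
    (hv : ContinuousOn (fun z : EuclideanSpace ℝ (Fin n) × ℝ => v z.1 z.2) (univ ×ˢ Ici t₀))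
    (h01 : t₀ ≤ t₁) (h12 : t₁ < t₂) (hM : 0 ≤ M) (hR : (M + 1) * (t₁ - t₀) < R / 2)
    (h0 : ∀ y ∈ Metric.closedBall x R, v y t₀ ≤ a) : v x t₁ ≤ a := by
  have := le_of_eikonalSubAbove (κ := M + 1) (p := 0) hv h01 h12 (by linarith)
    (fun q hq => ?_) hR hsub h0
  · simpa using this
  · rw [inner_zero_right]
    nlinarith

/-! ### Masses of sets. -/

theorem PositiveDensity.mass_mono {n : ℕ} {Θ : EuclideanSpace ℝ (Fin n) → ℝ}
    (hΘ : PositiveDensity Θ) {A B : Set (EuclideanSpace ℝ (Fin n))} (h : A ⊆ B) :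
    mass Θ A ≤ mass Θ B :=
  setIntegral_mono_set hΘ.integrable.integrableOn
    (Eventually.of_forall fun x => (hΘ.pos x).le) (LE.le.eventuallyLE h)

theorem PositiveDensity.mass_mem_Icc {n : ℕ} {Θ : EuclideanSpace ℝ (Fin n) → ℝ}
    (hΘ : PositiveDensity Θ) (A : Set (EuclideanSpace ℝ (Fin n))) :
    mass Θ A ∈ Icc 0 (mass Θ univ) := by
  refine ⟨?_, hΘ.mass_mono (subset_univ A)⟩
  simpa [mass] using hΘ.mass_mono (empty_subset A)

theorem PositiveDensity.mass_lt_mass {n : ℕ} {Θ : EuclideanSpace ℝ (Fin n) → ℝ}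
    (hΘ : PositiveDensity Θ) {A B O : Set (EuclideanSpace ℝ (Fin n))} (hAB : A ⊆ B)
    (hO : IsOpen O) (hne : O.Nonempty) (hOB : O ⊆ B) (hOA : Disjoint A O) :
    mass Θ A < mass Θ B := by
  have h1 : mass Θ (A ∪ O) = mass Θ A + mass Θ O :=
    setIntegral_union hOA hO.measurableSet hΘ.integrable.integrableOn hΘ.integrable.integrableOn
  have h2 : 0 < mass Θ O := by
    refine (setIntegral_pos_iff_support_of_nonneg_ae (Eventually.of_forall fun x => (hΘ.pos x).le)
      hΘ.integrable.integrableOn).2 ?_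
    have : Function.support Θ = univ := eq_univ_of_forall fun x => (hΘ.pos x).ne'
    rw [this, univ_inter]
    exact hO.measure_pos volume hne
  linarith [hΘ.mass_mono (union_subset hAB hOB)]

theorem PositiveDensity.mass_compl {n : ℕ} {Θ : EuclideanSpace ℝ (Fin n) → ℝ}
    (hΘ : PositiveDensity Θ) {A : Set (EuclideanSpace ℝ (Fin n))} (hA : MeasurableSet A) :
    mass Θ Aᶜ = mass Θ univ - mass Θ A := by
  simpa [mass] using setIntegral_compl hA hΘ.integrable

/-- Inner approximation of the mass of an open set by the sets of points at a fixed positive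
distance from its complement. -/
theorem PositiveDensity.tendsto_mass_inner {n : ℕ} {Θ : EuclideanSpace ℝ (Fin n) → ℝ}
    (hΘ : PositiveDensity Θ) {U : Set (EuclideanSpace ℝ (Fin n))} (hU : IsOpen U) :
    Tendsto (fun k : ℕ => mass Θ (Metric.thickening (1 / ((k : ℝ) + 1)) Uᶜ)ᶜ) atTop
      (𝓝 (mass Θ U)) := by
  have hUn : ⋃ k : ℕ, (Metric.thickening (1 / ((k : ℝ) + 1)) Uᶜ)ᶜ = U := by
    ext x
    simp only [mem_iUnion, mem_compl_iff, Metric.mem_thickening_iff, not_exists, not_and, not_lt]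
    constructor
    · rintro ⟨k, hk⟩
      by_contra hx
      have := hk x hx
      rw [dist_self] at this
      have h : (0 : ℝ) < 1 / ((k : ℝ) + 1) := by positivity
      linarith
    · intro hx
      obtain ⟨ε, hε, hball⟩ := Metric.isOpen_iff.1 hU x hx
      obtain ⟨k, hk⟩ := exists_nat_one_div_lt hε
      refine ⟨k, fun y hy => ?_⟩
      by_contra! hlt
      exact hy (hball (by rw [Metric.mem_ball, dist_comm]; linarith))
  have := tendsto_setIntegral_of_monotone (μ := volume) (f := Θ)
    (s := fun k : ℕ => (Metric.thickening (1 / ((k : ℝ) + 1)) Uᶜ)ᶜ)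
    (fun k => Metric.isOpen_thickening.measurableSet.compl)
    (fun k l hkl => compl_subset_compl.2 (Metric.thickening_mono
      (one_div_le_one_div_of_le (by positivity) (by simpa using hkl)) _))
    hΘ.integrable.integrableOn
  rwa [hUn] at this

/-! ### The one-sided estimate. -/

section OneSided

variable {n : ℕ} {g : ℝ → ℝ → ℝ} {Θ : EuclideanSpace ℝ (Fin n) → ℝ}
  {v : EuclideanSpace ℝ (Fin n) → ℝ → ℝ}

/-- The test function inequality for `v_t + |∇v| g(v, μ({v(·,t) < v(x,t)})) ≤ 0`. -/
def NonlocalSub (g : ℝ → ℝ → ℝ) (Θ : EuclideanSpace ℝ (Fin n) → ℝ)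
    (v : EuclideanSpace ℝ (Fin n) → ℝ → ℝ) : Prop :=
  ∀ (x : EuclideanSpace ℝ (Fin n)) (t : ℝ), 0 < t →
    ∀ φ : EuclideanSpace ℝ (Fin n) × ℝ → ℝ, ContDiff ℝ 1 φ →
      IsLocalMax (fun z : EuclideanSpace ℝ (Fin n) × ℝ => v z.1 z.2 - φ z) (x, t) →
      deriv (fun s => φ (x, s)) t +
        ‖gradient (fun y => φ (y, t)) x‖ * g (v x t) (mass Θ {y | v y t < v x t}) ≤ 0

/-- The structure of the velocity used in the one-sided estimate. -/
structure SpreadVelocity (g : ℝ → ℝ → ℝ) (I M : ℝ) : Prop where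
  nonneg : 0 ≤ M
  lower : ∀ r, ∀ q ∈ Icc 0 I, -M ≤ g r q
  mono_left : ∀ q ∈ Icc 0 I, Monotone fun r => g r q
  strictMono_right : ∀ r, StrictMonoOn (g r) (Icc 0 I)
  continuousOn_right : ∀ r, ContinuousOn (g r) (Icc 0 I)

theorem NonlocalSub.eikonalSubAbove (hsub : NonlocalSub g Θ v) {c a t₀ t₂ : ℝ} (ht₀ : 0 ≤ t₀)
    (hc : ∀ x t, t₀ < t → t < t₂ → a < v x t →
      c ≤ g (v x t) (mass Θ {y | v y t < v x t})) : EikonalSubAbove v c a t₀ t₂ := by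
  intro x t h0 h2 ha φ hφ hmax
  have h1 := hsub x t (ht₀.trans_lt h0) φ hφ hmax
  have h3 := mul_le_mul_of_nonneg_left (hc x t h0 h2 ha)
    (norm_nonneg (gradient (fun y => φ (y, t)) x))
  linarith

theorem NonlocalSub.finiteSpeed {M : ℝ} (hsub : NonlocalSub g Θ v)
    (hg : SpreadVelocity g (mass Θ univ) M) (hΘ : PositiveDensity Θ) (a : ℝ) {t₀ t₂ : ℝ}
    (ht₀ : 0 ≤ t₀) : EikonalSubAbove v (-M) a t₀ t₂ :=
  hsub.eikonalSubAbove ht₀ fun _ _ _ _ _ => hg.lower _ _ (hΘ.mass_mem_Icc _)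

theorem SpreadVelocity.le_apply {M : ℝ} (hg : SpreadVelocity g (mass Θ univ) M)
    (hΘ : PositiveDensity Θ) {a r : ℝ} {A B : Set (EuclideanSpace ℝ (Fin n))} (har : a ≤ r)
    (hAB : A ⊆ B) : g a (mass Θ A) ≤ g r (mass Θ B) :=
  (hg.mono_left _ (hΘ.mass_mem_Icc A) har).trans
    ((hg.strictMono_right r).monotoneOn (hΘ.mass_mem_Icc A) (hΘ.mass_mem_Icc B)
      (hΘ.mass_mono hAB))

/-- If the velocity of the front `{v < a}` is initially positive, then the sublevel sets `{v ≤ a}`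
spread forever with a uniform positive speed. -/
theorem NonlocalSub.exists_eikonalSubAbove {M a : ℝ} (hsub : NonlocalSub g Θ v)
    (hg : SpreadVelocity g (mass Θ univ) M) (hΘ : PositiveDensity Θ)
    (hv : ContinuousOn (fun z : EuclideanSpace ℝ (Fin n) × ℝ => v z.1 z.2) (univ ×ˢ Ici 0))
    (ha : 0 < g a (mass Θ {x | v x 0 < a})) :
    ∃ c, 0 < c ∧ ∀ t₂, EikonalSubAbove v c a 0 t₂ := by
  set U := {x | v x 0 < a}
  have hv0 : Continuous fun y => v y 0 :=
    hv.comp_continuous (f := fun y => (y, (0 : ℝ))) (by fun_prop) fun y => ⟨mem_univ _, self_mem_Ici⟩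
  have hU : IsOpen U := isOpen_lt hv0 continuous_const
  have htend := ((hg.continuousOn_right a _ (hΘ.mass_mem_Icc U)).tendsto.comp
    (tendsto_nhdsWithin_iff.2 ⟨hΘ.tendsto_mass_inner hU,
      Eventually.of_forall fun k => hΘ.mass_mem_Icc _⟩)).eventually_const_lt ha
  obtain ⟨k, hk⟩ := htend.exists
  simp only [Function.comp_apply] at hk
  set ρ : ℝ := 1 / ((k : ℝ) + 1)
  have hρ : 0 < ρ := by positivity
  set A := (Metric.thickening ρ Uᶜ)ᶜ
  have hA : ∀ x ∈ A, Metric.closedBall x (ρ / 2) ⊆ U := by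
    intro x hx y hy
    by_contra hyU
    refine hx (Metric.mem_thickening_iff.2 ⟨y, hyU, ?_⟩)
    rw [Metric.mem_closedBall, dist_comm] at hy
    linarith
  have hM := hg.nonneg
  obtain ⟨τ, hτ, hτM⟩ : ∃ τ, 0 < τ ∧ (M + 1) * τ < ρ / 2 / 2 := by
    refine ⟨ρ / (8 * (M + 1)), by positivity, ?_⟩
    have : (M + 1) * (ρ / (8 * (M + 1))) = ρ / 8 := by field_simp
    linarith
  have hspeed : ∀ t, A ⊆ {x | v x t ≤ a} → ∀ x, a < v x t →
      g a (mass Θ A) ≤ g (v x t) (mass Θ {y | v y t < v x t}) := fun t hAt x hx =>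
    hg.le_apply hΘ hx.le fun y hy => (hAt hy).trans_lt hx
  have hrest : ∀ t₀ : ℝ, 0 ≤ t₀ →
      ContinuousOn (fun z : EuclideanSpace ℝ (Fin n) × ℝ => v z.1 z.2) (univ ×ˢ Ici t₀) :=
    fun t₀ h => hv.mono (prod_mono le_rfl (Ici_subset_Ici.2 h))
  have hstep : ∀ t₀ : ℝ, 0 ≤ t₀ → U ⊆ {x | v x t₀ ≤ a} →
      ∀ t, t₀ ≤ t → t ≤ t₀ + τ → A ⊆ {x | v x t ≤ a} := by
    intro t₀ ht₀ hUt t h0 h1 x hx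
    refine (hsub.finiteSpeed hg hΘ a ht₀).le_of_closedBall (hrest t₀ ht₀) h0 (lt_add_one t) hM
      (R := ρ / 2) ?_ fun y hy => hUt (hA x hx hy)
    nlinarith
  -- Points of `U` stay in `{v ≤ a}` by positive speed with `p = 0`. Steps of `τ / 2` end strictly
  -- inside the interval of length `τ` on which the speed bound is known.
  have hiter : ∀ j : ℕ, U ⊆ {x | v x (j * (τ / 2)) ≤ a} := by
    intro j
    induction j with
    | zero =>
      intro x hx
      simpa using le_of_lt hx
    | succ j ih =>
      intro x hx
      have ht₀ : (0 : ℝ) ≤ j * (τ / 2) := by positivity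
      have heik : EikonalSubAbove v (g a (mass Θ A)) a (j * (τ / 2)) (j * (τ / 2) + τ) :=
        hsub.eikonalSubAbove ht₀ fun y t h0 h2 hy =>
          hspeed t (hstep _ ht₀ ih t h0.le h2.le) y hy
      have := heik.le_of_norm_le (t₁ := ((j + 1 : ℕ) : ℝ) * (τ / 2)) (p := 0) (hrest _ ht₀)
        (by push_cast; nlinarith) (by push_cast; nlinarith) (by simpa using hk.le) (ih hx)
      simpa using this
  refine ⟨_, hk, fun t₂ => hsub.eikonalSubAbove le_rfl fun x t h0 _ hx => hspeed t ?_ x hx⟩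
  have h1 := Nat.floor_le (a := t / (τ / 2)) (by positivity)
  have h2 := Nat.lt_floor_add_one (t / (τ / 2))
  rw [le_div_iff₀ (by positivity)] at h1
  rw [div_lt_iff₀ (by positivity)] at h2
  exact hstep _ (by positivity) (hiter ⌊t / (τ / 2)⌋₊) t h1 (by nlinarith)

theorem NonlocalSub.eventually_le {M h ε : ℝ} (hsub : NonlocalSub g Θ v)
    (hg : SpreadVelocity g (mass Θ univ) M) (hΘ : PositiveDensity Θ)
    (hv : ContinuousOn (fun z : EuclideanSpace ℝ (Fin n) × ℝ => v z.1 z.2) (univ ×ˢ Ici 0))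
    (hth : 0 ≤ g h (mass Θ {x | v x 0 ≤ h})) (hinf : ∀ b, h < b → ∃ x, v x 0 < b) (hε : 0 < ε)
    {K : Set (EuclideanSpace ℝ (Fin n))} (hK : IsCompact K) :
    ∀ᶠ t in atTop, ∀ x ∈ K, v x t ≤ h + ε := by
  have hv0 : Continuous fun y => v y 0 :=
    hv.comp_continuous (f := fun y => (y, (0 : ℝ))) (by fun_prop) fun y => ⟨mem_univ _, self_mem_Ici⟩
  by_cases hsup : ∃ y, h < v y 0
  swap
  -- A datum bounded by `h` stays so: finite speed applied on a ball large enough for time `t`.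
  · push Not at hsup
    filter_upwards [eventually_ge_atTop 0] with t ht x _
    have := (hsub.finiteSpeed hg hΘ h le_rfl).le_of_closedBall hv ht (lt_add_one t) hg.nonneg
      (R := 2 * ((M + 1) * t) + 1) (x := x) (by linarith) fun y _ => hsup y
    linarith
  obtain ⟨y, hy⟩ := hsup
  obtain ⟨a, hha, ha⟩ := exists_between (lt_min (lt_add_of_pos_right h hε) hy)
  obtain ⟨haε, hay⟩ := lt_min_iff.1 ha
  have hmass : mass Θ {x | v x 0 ≤ h} < mass Θ {x | v x 0 < a} := by
    obtain ⟨b, hhb, hba⟩ := exists_between hha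
    obtain ⟨x, hx⟩ := hinf b hhb
    obtain ⟨z, hz⟩ := mem_range_of_exists_le_of_exists_ge hv0 ⟨x, hx.le⟩ ⟨y, (hba.trans hay).le⟩
    refine hΘ.mass_lt_mass (O := {x | h < v x 0 ∧ v x 0 < a}) (fun x hx => lt_of_le_of_lt hx hha)
      ((isOpen_lt continuous_const hv0).and (isOpen_lt hv0 continuous_const))
      ⟨z, ?_, ?_⟩ (fun x hx => hx.2) ?_
    · simpa [hz] using hhb
    · simpa [hz] using hba
    · exact disjoint_left.2 fun x hx hx' => not_lt.2 hx hx'.1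
  have hpos : 0 < g a (mass Θ {x | v x 0 < a}) :=
    (hth.trans (hg.mono_left _ (hΘ.mass_mem_Icc _) hha.le)).trans_lt
      (hg.strictMono_right a (hΘ.mass_mem_Icc _) (hΘ.mass_mem_Icc _) hmass)
  obtain ⟨c, hc, heik⟩ := hsub.exists_eikonalSubAbove hg hΘ hv hpos
  obtain ⟨x₀, hx₀⟩ := hinf a hha
  obtain ⟨C, hC⟩ := hK.isBounded.exists_norm_le
  filter_upwards [eventually_gt_atTop 0, eventually_ge_atTop ((C + ‖x₀‖) / c)] with t ht htc x hx
  -- Travel from `x₀` to `x` in time `t`; the required speed is at most `c` once `t ≥ (C + ‖x₀‖) /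
  -- c`.
  have hle := (heik (t + 1)).le_of_norm_le (p := t⁻¹ • (x - x₀)) hv ht.le (lt_add_one t) ?_ hx₀.le
  · rw [sub_zero, smul_inv_smul₀ ht.ne', add_sub_cancel] at hle
    linarith
  · rw [norm_smul, norm_inv, Real.norm_of_nonneg ht.le, inv_mul_le_iff₀ ht]
    rw [div_le_iff₀ hc] at htc
    linarith [norm_sub_le x x₀, hC x hx]

end OneSided

/-! ### Duality `u ↦ -u` and conclusion. -/

theorem IsViscositySubsolution.nonlocalSub {n : ℕ} {f : ℝ → ℝ → ℝ}
    {Θ : EuclideanSpace ℝ (Fin n) → ℝ} {u : EuclideanSpace ℝ (Fin n) → ℝ → ℝ}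
    (hu : IsViscositySubsolution f Θ u) : NonlocalSub f Θ u :=
  fun x t ht φ hφ hmax => hu.test x t ht φ hφ.contDiffOn hmax

/-- The non-strict sublevel set of `u` is the complement of a strict sublevel set of `-u`, so its
mass is the total mass minus the one that enters the subsolution inequality for `-u`. -/
theorem IsViscositySupersolution.nonlocalSub_neg {n : ℕ} {f : ℝ → ℝ → ℝ}
    {Θ : EuclideanSpace ℝ (Fin n) → ℝ} {u : EuclideanSpace ℝ (Fin n) → ℝ → ℝ}
    (hu : IsViscositySupersolution f Θ u) (hΘ : PositiveDensity Θ)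
    (hut : ∀ t, 0 < t → Continuous fun x => u x t) :
    NonlocalSub (fun r q => -f (-r) (mass Θ univ - q)) Θ (fun x t => -u x t) := by
  intro x t ht φ hφ hmax
  have hmin : IsLocalMin (fun z : EuclideanSpace ℝ (Fin n) × ℝ => u z.1 z.2 - (-φ) z) (x, t) := by
    have := hmax.neg
    simpa [sub_eq_add_neg, add_comm] using this
  have h := hu.test x t ht (-φ) hφ.neg.contDiffOn hmin
  have hcompl : {y | u y t ≤ u x t} = {y | -u y t < -u x t}ᶜ := by
    ext y
    simp
  have hmeas : MeasurableSet {y | -u y t < -u x t} :=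
    (isOpen_lt (hut t ht).neg continuous_const).measurableSet
  rw [hcompl, hΘ.mass_compl hmeas] at h
  have hgrad : ‖gradient (fun y => (-φ) (y, t)) x‖ = ‖gradient (fun y => φ (y, t)) x‖ := by
    simp only [gradient, Pi.neg_apply, fderiv_fun_neg, map_neg, norm_neg]
  have hderiv : deriv (fun s => (-φ) (x, s)) t = -deriv (fun s => φ (x, s)) t := by
    simp only [Pi.neg_apply, deriv.fun_neg]
  rw [hgrad, hderiv] at h
  simp only [neg_neg]
  linarith

theorem VelocityMonotone.monotone_left {f : ℝ → ℝ → ℝ} (hf : VelocityMonotone f) {q : ℝ}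
    (hq : 0 ≤ q) : Monotone fun r => f r q :=
  monotone_iff_forall_lt.2 fun r₁ r₂ h => hf.mono_left r₁ r₂ q h hq

theorem VelocityRegular.continuousOn_right {f : ℝ → ℝ → ℝ} (hf : VelocityRegular f) (r : ℝ) :
    ContinuousOn (f r) (Ici 0) :=
  hf.continuousOn.comp (f := fun q : ℝ => (r, q)) (by fun_prop) fun _ hq => ⟨mem_univ _, hq⟩

theorem exists_spreadVelocity {f : ℝ → ℝ → ℝ} (hf : VelocityRegular f) (hmono : VelocityMonotone f)
    (I : ℝ) :
    ∃ M, SpreadVelocity f I M ∧ SpreadVelocity (fun r q => -f (-r) (I - q)) I M := by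
  obtain ⟨M, hM⟩ := hf.bounded
  have hsub : ∀ q ∈ Icc 0 I, I - q ∈ Icc 0 I := fun q hq => ⟨by linarith [hq.2], by linarith [hq.1]⟩
  refine ⟨M, ⟨(abs_nonneg _).trans (hM 0 0 le_rfl), fun r q hq => (abs_le.1 (hM r q hq.1)).1,
    fun q hq => hmono.monotone_left hq.1,
    fun r q₁ h₁ q₂ _ h => hmono.strictMono_right r q₁ q₂ h₁.1 h,
    fun r => (hf.continuousOn_right r).mono Icc_subset_Ici_self⟩,
    ⟨(abs_nonneg _).trans (hM 0 0 le_rfl),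
    fun r q hq => neg_le_neg (abs_le.1 (hM (-r) (I - q) (hsub q hq).1)).2,
    fun q hq r₁ r₂ h => neg_le_neg (hmono.monotone_left (hsub q hq).1 (neg_le_neg h)),
    fun r q₁ _ q₂ h₂ h => neg_lt_neg (hmono.strictMono_right (-r) _ _ (hsub q₂ h₂).1
      (by linarith)),
    fun r => ((hf.continuousOn_right (-r)).comp (by fun_prop) fun q hq => (hsub q hq).1).neg⟩⟩

theorem proposition4p1 (n : ℕ) (f : ℝ → ℝ → ℝ) (Θ u₀ : EuclideanSpace ℝ (Fin n) → ℝ)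
    (hf : VelocityRegular f) (hmono : VelocityMonotone f) (hΘ : PositiveDensity Θ) (hu₀ : CoerciveDatum u₀)
    (hbar : ℝ) (hthr : IsThreshold f Θ u₀ hbar)
    (hinf : (⨅ x, (u₀ x : EReal)) ≤ (hbar : EReal))
    (hsup : (hbar : EReal) ≤ ⨆ x, (u₀ x : EReal))
    (u : EuclideanSpace ℝ (Fin n) → ℝ → ℝ) (hu : IsCauchySolution f Θ u₀ u)
    (K : Set (EuclideanSpace ℝ (Fin n))) (hK : IsCompact K) :
    TendstoUniformlyOn (fun (t : ℝ) (x : EuclideanSpace ℝ (Fin n)) => u x t)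
      (fun _ => hbar) atTop K := by
  obtain ⟨M, hg, hg'⟩ := exists_spreadVelocity hf hmono (mass Θ univ)
  have hut : ∀ t, 0 ≤ t → Continuous fun x => u x t := fun t ht =>
    hu.continuousOn.comp_continuous (f := fun y => (y, t)) (by fun_prop) fun y => ⟨mem_univ _, ht⟩
  have hupper : ∀ ε, 0 < ε → ∀ᶠ t in atTop, ∀ x ∈ K, u x t ≤ hbar + ε := by
    intro ε hε
    refine hu.solution.sub.nonlocalSub.eventually_le hg hΘ hu.continuousOn ?_ ?_ hε hK
    · simpa only [hu.initial] using hthr.2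
    · intro b hb
      obtain ⟨x, hx⟩ := iInf_lt_iff.1 (hinf.trans_lt (EReal.coe_lt_coe_iff.2 hb))
      exact ⟨x, by simpa only [hu.initial] using EReal.coe_lt_coe_iff.1 hx⟩
  have hlower : ∀ ε, 0 < ε → ∀ᶠ t in atTop, ∀ x ∈ K, -u x t ≤ -hbar + ε := by
    intro ε hε
    refine (hu.solution.super.nonlocalSub_neg hΘ fun t ht => hut t ht.le).eventually_le hg' hΘ
      hu.continuousOn.neg ?_ ?_ hε hK
    · have hcompl : {x | -u x 0 ≤ -hbar} = {x | u₀ x < hbar}ᶜ := by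
        ext x
        simp [hu.initial]
      have hmeas : MeasurableSet {x | u₀ x < hbar} :=
        (isOpen_lt hu₀.uniformContinuous.continuous continuous_const).measurableSet
      rw [hcompl, hΘ.mass_compl hmeas, neg_neg, sub_sub_cancel]
      exact neg_nonneg.2 hthr.1
    · intro b hb
      obtain ⟨x, hx⟩ := lt_iSup_iff.1 ((EReal.coe_lt_coe_iff.2 (neg_lt.1 hb)).trans_le hsup)
      refine ⟨x, ?_⟩
      rw [hu.initial]
      exact neg_lt.1 (EReal.coe_lt_coe_iff.1 hx)
  rw [Metric.tendstoUniformlyOn_iff]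
  intro ε hε
  filter_upwards [hupper (ε / 2) (half_pos hε), hlower (ε / 2) (half_pos hε)] with t h1 h2 x hx
  rw [Real.dist_eq, abs_lt]
  constructor <;> linarith [h1 x hx, h2 x hx]
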